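/- Let $R$ be a commutative ring with identity, and let $n,m,k\ge 0$ be integers. Assume that $R$ is - $n$-FC: $R$ is coherent and $\mathrm{FP\text{-}id}_R(R)\le n$, where the FP-injective dimension $\mathrm{FP\text{-}id}_R(N)$ of an $R$-module $N$ is the least integer $d\ge 0$ such that $\mathrm{Ext}^{d+1}_R(P,N)=0$ for all finitely presented $R$-modules $P$ (and $\infty$ if there is no such $d$); and - $m$-perfect: every flat $R$-module has projective dimension at most $m$. Call an $R$-module Gorenstein projective if it is isomorphic to the image of $P^{-1}\to P^0$ for some exact complex $\cdots\to P^{-1}\to P^0\to P^1\to\cdots$ of projective $R$-modules that remains exact under $\mathrm{Hom}_R(-,Q)$ for every projective $R$-module $Q$. For an $R$-module $M$, let the Gorenstein projective dimension $\mathrm{Gpd}_R(M)$ be the least integer $d\ge0$ for which there is an exact sequence $0\to G_d\to\cdots\to G_0\to M\to 0$ with all $G_i$ Gorenstein projective (and $\infty$ if there is no such $d$). Then, for every $R$-module $M$, $$\mathrm{Gpd}_R(M)\le k\iff \mathrm{Ext}^j_R(M,P)=0\ \text{ for all } j\ge k+1 \text{ and all } R\text{-modules } P \text{ with } \mathrm{pd}_R(P)<\infty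 .$$ -/

import Mathlib

open CategoryTheory

universe u

/-- A commutative ring is coherent if each of its finitely generated ideals is finitely
presented. -/
def IsCoherentRing (R : Type u) [CommRing R] : Prop :=
  ∀ I : Ideal R, I.FG → Module.FinitePresentation R I

/-- The FP-injective dimension of an `R`-module `M`: the least `d : ℕ` such that
`Ext^{d+1}_R(P, M) = 0` for all finitely presented `R`-modules `P` (and `⊤` if there is none). -/
noncomputable def fpInjectiveDimension {R : Type u} [CommRing R] (M : ModuleCat.{u} R) : ℕ∞ :=
  ⨅ (d : ℕ) (_ : ∀ P : ModuleCat.{u} R, Module.FinitePresentation R P →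
    Subsingleton (Abelian.Ext.{u} P M (d + 1))), (d : ℕ∞)

/-- `R` is `n`-FC: it is coherent and its self-FP-injective dimension is at most `n`. -/
def IsNFC (n : ℕ) (R : Type u) [CommRing R] : Prop :=
  IsCoherentRing R ∧ fpInjectiveDimension (ModuleCat.of R R) ≤ n

/-- `R` is `m`-perfect: every flat `R`-module has projective dimension at most `m`. -/
def IsNPerfect (m : ℕ) (R : Type u) [CommRing R] : Prop :=
  ∀ F : ModuleCat.{u} R, Module.Flat R F → HasProjectiveDimensionLE F m

/-- `M` is Gorenstein projective: there is an exact complex `⋯ → P⁻¹ → P⁰ → P¹ → ⋯` of projective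
modules which stays exact under `Hom(-, Q)` for every projective module `Q`, and such that
`M` is isomorphic to the image of `P⁻¹ → P⁰`. -/
def IsGorensteinProjective {R : Type u} [CommRing R] (M : ModuleCat.{u} R) : Prop :=
  ∃ P : CochainComplex (ModuleCat.{u} R) ℤ,
    (∀ i, Projective (P.X i)) ∧
    P.Acyclic ∧
    (∀ Q : ModuleCat.{u} R, Projective Q → ∀ (i : ℤ) (f : P.X i ⟶ Q),
      P.d (i - 1) i ≫ f = 0 → ∃ g : P.X (i + 1) ⟶ Q, P.d i (i + 1) ≫ g = f) ∧
    Nonempty (M ≃ₗ[R] LinearMap.range (P.d (-1) 0).hom)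

/-- There is an exact sequence `0 → G_k → ⋯ → G_1 → G_0 → M → 0` with all `G_i` Gorenstein
projective. The sequence is continued by zero modules in degrees `i > k`. -/
def HasGorensteinProjectiveResolution {R : Type u} [CommRing R] (M : ModuleCat.{u} R)
    (k : ℕ) : Prop :=
  ∃ (G : ChainComplex (ModuleCat.{u} R) ℕ) (ε : G.X 0 ⟶ M),
    (∀ i, i ≤ k → IsGorensteinProjective (G.X i)) ∧
    (∀ i, k < i → Subsingleton (G.X i)) ∧
    Function.Surjective ε ∧
    Function.Exact (G.d 1 0) ε ∧
    ∀ i, Function.Exact (G.d (i + 2) (i + 1)) (G.d (i + 1) i)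

/-- The Gorenstein projective dimension of `M`: the least length of a resolution of `M` by
Gorenstein projective modules (and `⊤` if there is none). -/
noncomputable def gorensteinProjectiveDimension {R : Type u} [CommRing R]
    (M : ModuleCat.{u} R) : ℕ∞ :=
  ⨅ (k : ℕ) (_ : HasGorensteinProjectiveResolution M k), (k : ℕ∞)

/-!
Call a module orthogonal if its positive `Ext` groups into all modules of finite projective
dimension vanish (`IsExtOrthogonal`). By dimension shifting along a resolution, the theorem says
that Gorenstein projective and orthogonal modules coincide. A Gorenstein projective module is
orthogonal over any ring (`IsGorensteinProjective.isExtOrthogonal`): exactness of a complete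
resolution under `Hom(-, Q)` is the vanishing of `Ext¹` from its images into projective modules `Q`.

For the converse, a complete resolution of an orthogonal module `K` is spliced from short exact
sequences of orthogonal modules with projective middle terms. To the left, free covers do. To the
right, one needs an embedding of `K` into a free module with orthogonal cokernel
(`IsExtOrthogonal.exists_embedding`), and this is where the hypotheses on `R` enter:

* Maps from `K` to free modules take values in free modules of bounded rank, so all maps from `K`
  to projective modules factor through one map from `K` to a product `N` of free modules. As `R` is
  coherent, `N` is flat (Chase), so it has finite projective dimension. As `K` is orthogonal, `K → N`
  lifts to a free cover of `N`, which yields a projective preenvelope `g` of `K`. The cokernel of an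
  injective preenvelope is orthogonal.
* `K` embeds into a power of the character module `R⁺ = Hom_ℤ(R, ℚ/ℤ)`. If this power has finite
  projective dimension, then the embedding lifts to a free cover; so `K` embeds into a free module,
  and `g` is injective.
* For finitely presented `P` over a coherent ring, `Ext^{i+1}(P, R) = 0` implies
  `Tor_{i+1}(P, R⁺) = 0`, and the same for powers of `R⁺`. So these powers have finite flat
  dimension, hence finite projective dimension
  (`IsNFC.hasProjectiveDimensionLE_pi_characterModule`). Here `Tor` is expressed by the solvability
  of linear systems over `R` (`Matrix.TorVanishes`), which matches the equational criterion for
  flatness.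
-/

/-! ### Matrices acting on modules -/

section MatrixAction

open scoped Matrix

variable {R : Type*} [CommRing R] {m n p : Type*} [Fintype n] [Fintype p]

/-- The action of a matrix over `R` on column vectors with entries in an `R`-module `X`. -/
def Matrix.smulVec (X : Type*) [AddCommGroup X] [Module R X] (A : Matrix m n R) :
    (n → X) →ₗ[R] (m → X) where
  toFun x i := ∑ j, A i j • x j
  map_add' x y := by ext i; simp [Finset.sum_add_distrib]
  map_smul' r x := by ext i; simp [Finset.smul_sum, smul_comm r]

variable {X Y : Type*} [AddCommGroup X] [Module R X] [AddCommGroup Y] [Module R Y]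

lemma Matrix.smulVec_apply (A : Matrix m n R) (x : n → X) (i : m) :
    A.smulVec X x i = ∑ j, A i j • x j := rfl

lemma Matrix.smulVec_mul (A : Matrix m n R) (B : Matrix n p R) (x : p → X) :
    (A * B).smulVec X x = A.smulVec X (B.smulVec X x) := by
  ext i
  simp only [smulVec_apply, Matrix.mul_apply, Finset.sum_smul, Finset.smul_sum, mul_smul]
  exact Finset.sum_comm

lemma Matrix.smulVec_map (A : Matrix m n R) (f : X →ₗ[R] Y) (x : n → X) :
    A.smulVec Y (fun j => f (x j)) = fun i => f (A.smulVec X x i) := by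
  ext i; simp [smulVec_apply]

lemma Matrix.coe_smulVec (A : Matrix m n R) (N : Submodule R X) (x : n → N) (i : m) :
    (A.smulVec N x i : X) = A.smulVec X (fun j => (x j : X)) i := by
  simp [smulVec_apply]

lemma Matrix.smulVec_self (A : Matrix m n R) : A.smulVec R = A.mulVecLin := by
  ext x i; simp [smulVec_apply, Matrix.mulVec, dotProduct]

/-- The columns of `B` generate the kernel of the linear map given by `A`. -/
def Matrix.IsSyzygy (A : Matrix m n R) (B : Matrix n p R) : Prop :=
  Function.Exact (B.smulVec R) (A.smulVec R)

lemma Matrix.IsSyzygy.mul_eq_zero [DecidableEq p] {A : Matrix m n R} {B : Matrix n p R}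
    (h : A.IsSyzygy B) : A * B = 0 := by
  ext i j
  have := congrFun (h.apply_apply_eq_zero (Pi.single j 1)) i
  simpa [Matrix.mul_apply, Matrix.smulVec_apply, Pi.single_apply] using this

/-- Solvability of a linear system passes from `R` to free modules, coordinate by coordinate. -/
lemma Matrix.IsSyzygy.exists_of_finsupp {A : Matrix m n R} {B : Matrix n p R}
    (h : A.IsSyzygy B) {κ : Type*} (x : n → κ →₀ R) (hx : A.smulVec (κ →₀ R) x = 0) :
    ∃ y : p → κ →₀ R, B.smulVec (κ →₀ R) y = x := by
  classical
  have hk : ∀ k, ∃ w : p → R, B.smulVec R w = fun j => x j k := by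
    intro k
    refine (h _).1 ?_
    have := A.smulVec_map (Finsupp.lapply (R := R) (M := R) k) x
    simp only [Finsupp.lapply_apply] at this
    rw [this, hx]
    rfl
  choose w hw using hk
  refine ⟨fun j => ∑ k ∈ Finset.univ.biUnion (fun i => (x i).support), Finsupp.single k (w k j), ?_⟩
  ext i k
  simp only [smulVec_apply, Finsupp.coe_finsetSum, Finset.sum_apply, Finsupp.smul_apply,
    Finsupp.single_apply, Finset.sum_ite_eq']
  split_ifs with hmem
  · simpa [smulVec_apply] using congrFun (hw k) i
  · have : x i k = 0 := by
      by_contra hne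
      exact hmem (Finset.mem_biUnion.2 ⟨i, Finset.mem_univ _, by simpa using hne⟩)
    simp [this]

lemma CharacterModule.sum_apply {A ι : Type*} [AddCommGroup A] (s : Finset ι)
    (c : ι → CharacterModule A) (a : A) : (∑ i ∈ s, c i) a = ∑ i ∈ s, c i a :=
  map_sum (AddMonoidHom.eval a : CharacterModule A →+ AddCircle (1 : ℚ)) c s

/-- Taking character modules turns the exact sequence given by `Aᵀ` and `Bᵀ` into the
sequence given by `B` and `A`, which is exact because `ℚ/ℤ` is injective. -/
lemma Matrix.exists_of_characterModule [Fintype m] {A : Matrix m n R} {B : Matrix n p R}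
    (h : Bᵀ.IsSyzygy Aᵀ) (x : n → CharacterModule R)
    (hx : A.smulVec (CharacterModule R) x = 0) :
    ∃ y : p → CharacterModule R, B.smulVec (CharacterModule R) y = x := by
  classical
  let Φ : CharacterModule (n → R) :=
    ∑ j, CharacterModule.dual (LinearMap.proj (R := R) (φ := fun _ => R) j) (x j)
  have hΦ (v : n → R) : Φ v = ∑ j, x j (v j) := CharacterModule.sum_apply _ _ _
  have hker : ∀ v ∈ LinearMap.ker (Bᵀ.smulVec R), Φ v = 0 := by
    intro v hv
    obtain ⟨w, rfl⟩ := (h v).1 hv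
    rw [hΦ]
    have : ∑ i, (A.smulVec (CharacterModule R) x i) (w i) = 0 := by
      rw [hx]; exact Finset.sum_eq_zero fun i _ => rfl
    rw [← this]
    simp only [smulVec_apply, Matrix.transpose_apply, map_sum, CharacterModule.sum_apply]
    rw [Finset.sum_comm]
    simp [CharacterModule.smul_apply]
  let Φ' : CharacterModule ((n → R) ⧸ LinearMap.ker (Bᵀ.smulVec R)) :=
    QuotientAddGroup.lift _ Φ hker
  obtain ⟨Ψ, hΨ⟩ := CharacterModule.dual_surjective_of_injective
    ((LinearMap.ker (Bᵀ.smulVec R)).liftQ (Bᵀ.smulVec R) le_rfl)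
    (LinearMap.ker_eq_bot.1 (Submodule.ker_liftQ_eq_bot _ _ _ le_rfl)) Φ'
  have hΨ' (v : n → R) : Ψ (Bᵀ.smulVec R v) = Φ v := congr($hΨ (Submodule.Quotient.mk v))
  refine ⟨fun k => CharacterModule.dual (LinearMap.single R (fun _ => R) k) Ψ, ?_⟩
  ext j r
  have := hΨ' (Pi.single j r)
  rw [hΦ, Finset.sum_eq_single j (fun i _ hi => by simp [hi]) (by simp), Pi.single_eq_same] at this
  have e : Bᵀ.smulVec R (Pi.single j r) = ∑ k, Pi.single k (B j k • r) := by
    ext k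
    simp [smulVec_apply, Finset.sum_apply, Pi.single_apply]
  rw [← this, smulVec_apply, CharacterModule.sum_apply, e, map_sum]
  rfl

end MatrixAction

/-! ### Coherent rings -/

section Coherent

variable {R : Type u} [CommRing R]

/-- Over a coherent ring, the kernel of a map between finite free modules is finitely generated.
The coordinates of the target are treated one at a time. -/
lemma IsCoherentRing.ker_fg (hR : IsCoherentRing R) :
    ∀ {a b : ℕ} (f : (Fin b → R) →ₗ[R] (Fin a → R)), (LinearMap.ker f).FG := by
  intro a
  induction a with
  | zero =>
    intro b f
    have : LinearMap.ker f = ⊤ := by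
      ext x; simp [Subsingleton.elim (f x) 0]
    rw [this]; exact Module.Finite.fg_top
  | succ a ih =>
    intro b f
    let g : (Fin b → R) →ₗ[R] R := LinearMap.proj 0 ∘ₗ f
    have hg : (LinearMap.ker g).FG := by
      have h1 : (LinearMap.range g).FG := by
        rw [LinearMap.range_eq_map]; exact Module.Finite.fg_top.map g
      have := hR (LinearMap.range g) h1
      have h2 := Module.FinitePresentation.fg_ker g.rangeRestrict g.surjective_rangeRestrict
      rwa [LinearMap.ker_rangeRestrict] at h2
    obtain ⟨c, s, hs⟩ := Submodule.fg_iff_exists_fin_generating_family.1 hg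
    let h : (Fin c → R) →ₗ[R] (Fin b → R) := Fintype.linearCombination R s
    have hh : LinearMap.range h = LinearMap.ker g := by
      rw [← hs]; exact Fintype.range_linearCombination R s
    let t : (Fin (a + 1) → R) →ₗ[R] (Fin a → R) := LinearMap.funLeft R R Fin.succ
    have := (ih (t ∘ₗ f ∘ₗ h)).map h
    convert this using 1
    ext v
    simp only [LinearMap.mem_ker, Submodule.mem_map, LinearMap.comp_apply]
    constructor
    · intro hv
      have : v ∈ LinearMap.range h := by
        rw [hh, LinearMap.mem_ker]; simp [g, hv]
      obtain ⟨w, rfl⟩ := this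
      exact ⟨w, by rw [hv, map_zero], rfl⟩
    · rintro ⟨w, hw, rfl⟩
      have h0 : g (h w) = 0 := by
        have : h w ∈ LinearMap.ker g := hh ▸ LinearMap.mem_range_self h w
        exact this
      ext i
      refine Fin.cases ?_ (fun i => ?_) i
      · exact h0
      · exact congrFun hw i

lemma IsCoherentRing.exists_isSyzygy (hR : IsCoherentRing R) {a b : ℕ}
    (A : Matrix (Fin a) (Fin b) R) : ∃ (c : ℕ) (B : Matrix (Fin b) (Fin c) R), A.IsSyzygy B := by
  obtain ⟨c, s, hs⟩ := Submodule.fg_iff_exists_fin_generating_family.1 (hR.ker_fg (A.smulVec R))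
  refine ⟨c, Matrix.of fun i j => s j i, ?_⟩
  rw [Matrix.IsSyzygy, LinearMap.exact_iff, ← hs, Matrix.smulVec_self, Matrix.range_mulVecLin]
  rfl

/-- **Chase**: over a coherent ring, products of free modules are flat. -/
lemma IsCoherentRing.flat_pi_finsupp (hR : IsCoherentRing R) (ι κ : Type*) :
    Module.Flat R (ι → κ →₀ R) := by
  refine Module.Flat.of_forall_isTrivialRelation fun {l f x} hfx => ?_
  let A : Matrix (Fin 1) (Fin l) R := Matrix.of fun _ j => f j
  obtain ⟨c, B, hB⟩ := hR.exists_isSyzygy A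
  have hy : ∀ i, ∃ y : Fin c → κ →₀ R, B.smulVec _ y = fun j => x j i := fun i =>
    hB.exists_of_finsupp _ (by
      ext1 r
      simpa [A, Matrix.smulVec_apply] using congrFun hfx i)
  choose y hy using hy
  refine ⟨c, B, fun q i => y i q, fun j => ?_, fun q => ?_⟩
  · ext1 i
    rw [← congrFun (hy i) j, Matrix.smulVec_apply, Finset.sum_apply]
    rfl
  · simpa [A, Matrix.mul_apply] using congrFun (congrFun hB.mul_eq_zero 0) q

end Coherent

/-! ### Short exact sequences and `Ext` -/

section ExtUtilities

universe w v u'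

open Abelian

variable {C : Type u'} [Category.{v} C] [Abelian C] [HasExt.{w} C]

namespace CategoryTheory.ShortComplex.ShortExact

variable {S : ShortComplex C} (hS : S.ShortExact)
include hS

lemma subsingleton_ext_X₁ {Y : C} {j : ℕ} (h₂ : Subsingleton (Ext.{w} S.X₂ Y j))
    (h₃ : Subsingleton (Ext.{w} S.X₃ Y (j + 1))) : Subsingleton (Ext.{w} S.X₁ Y j) := by
  refine subsingleton_of_forall_eq 0 fun x => ?_
  obtain ⟨y, rfl⟩ := Ext.contravariant_sequence_exact₁ hS Y x (add_comm 1 j) (Subsingleton.elim _ _)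
  rw [Subsingleton.elim y 0, Ext.comp_zero]

lemma subsingleton_ext_X₃ {Y : C} {j : ℕ} (h₁ : Subsingleton (Ext.{w} S.X₁ Y j))
    (h₂ : Subsingleton (Ext.{w} S.X₂ Y (j + 1))) : Subsingleton (Ext.{w} S.X₃ Y (j + 1)) := by
  refine subsingleton_of_forall_eq 0 fun x => ?_
  obtain ⟨y, rfl⟩ := Ext.contravariant_sequence_exact₃ hS Y x (Subsingleton.elim _ _) (add_comm 1 j)
  rw [Subsingleton.elim y 0, Ext.comp_zero]

/-- If all maps from `S.X₁` to `Y` extend along `S.f`, then `Ext¹(S.X₃, Y)` embeds into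
`Ext¹(S.X₂, Y)`. -/
lemma subsingleton_ext_one_X₃ {Y : C} (h₁ : ∀ f : S.X₁ ⟶ Y, ∃ g, S.f ≫ g = f)
    (h₂ : Subsingleton (Ext.{w} S.X₂ Y 1)) : Subsingleton (Ext.{w} S.X₃ Y 1) := by
  refine subsingleton_of_forall_eq 0 fun x => ?_
  obtain ⟨y, rfl⟩ := Ext.contravariant_sequence_exact₃ hS Y x (Subsingleton.elim _ _) (add_zero 1)
  obtain ⟨f, rfl⟩ := Ext.homEquiv₀.symm.surjective y
  obtain ⟨g, rfl⟩ := h₁ f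
  rw [Ext.homEquiv₀_symm_apply, ← Ext.mk₀_comp_mk₀, hS.extClass_comp_assoc]

lemma exists_extension {Y : C} (h : Subsingleton (Ext.{w} S.X₃ Y 1)) (f : S.X₁ ⟶ Y) :
    ∃ g, S.f ≫ g = f := by
  obtain ⟨y, hy⟩ := Ext.contravariant_sequence_exact₁ hS Y (Ext.mk₀ f) (add_zero 1)
    (Subsingleton.elim _ _)
  obtain ⟨g, rfl⟩ := Ext.homEquiv₀.symm.surjective y
  exact ⟨g, Ext.homEquiv₀.symm.injective (by simpa using hy)⟩

lemma exists_lift {X : C} (h : Subsingleton (Ext.{w} X S.X₁ 1)) (f : X ⟶ S.X₃) :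
    ∃ g, g ≫ S.g = f := by
  obtain ⟨y, hy⟩ := Ext.covariant_sequence_exact₃ X hS (Ext.mk₀ f) (zero_add 1)
    (Subsingleton.elim _ _)
  obtain ⟨g, rfl⟩ := Ext.homEquiv₀.symm.surjective y
  exact ⟨g, Ext.homEquiv₀.symm.injective (by simpa using hy)⟩

lemma subsingleton_ext_to_X₃ {X : C} {j : ℕ} (h₂ : Subsingleton (Ext.{w} X S.X₂ j))
    (h₁ : Subsingleton (Ext.{w} X S.X₁ (j + 1))) : Subsingleton (Ext.{w} X S.X₃ j) := by
  refine subsingleton_of_forall_eq 0 fun x => ?_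
  obtain ⟨y, rfl⟩ := Ext.covariant_sequence_exact₃ X hS x rfl (Subsingleton.elim _ _)
  rw [Subsingleton.elim y 0, Ext.zero_comp]

end CategoryTheory.ShortComplex.ShortExact

lemma CategoryTheory.Iso.subsingleton_ext {X X' : C} (e : X ≅ X') {Y : C} {j : ℕ}
    (h : Subsingleton (Ext.{w} X Y j)) : Subsingleton (Ext.{w} X' Y j) := by
  refine subsingleton_of_forall_eq 0 fun x => ?_
  rw [← x.mk₀_id_comp, ← e.inv_hom_id, ← Ext.mk₀_comp_mk₀, Ext.comp_assoc_of_second_deg_zero,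
    Subsingleton.elim ((Ext.mk₀ e.hom).comp x (zero_add j)) 0, Ext.comp_zero]

end ExtUtilities

section ModuleUtilities

variable {R : Type u} [CommRing R]

lemma ModuleCat.shortExact_of_linearMap {A B C : Type u} [AddCommGroup A] [Module R A]
    [AddCommGroup B] [Module R B] [AddCommGroup C] [Module R C] (f : A →ₗ[R] B) (g : B →ₗ[R] C)
    (hf : Function.Injective f) (hfg : Function.Exact f g) (hg : Function.Surjective g) :
    (ShortComplex.mk (ModuleCat.ofHom f) (ModuleCat.ofHom g)
      (by ext x; exact hfg.apply_apply_eq_zero x)).ShortExact where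
  exact := (ShortComplex.ShortExact.moduleCat_exact_iff_function_exact _).2 hfg
  mono_f := (ModuleCat.mono_iff_injective _).2 hf
  epi_g := (ModuleCat.epi_iff_surjective _).2 hg

lemma ModuleCat.shortExact_ker {A B : Type u} [AddCommGroup A] [Module R A]
    [AddCommGroup B] [Module R B] (g : A →ₗ[R] B) (hg : Function.Surjective g) :
    (ShortComplex.mk (ModuleCat.ofHom (LinearMap.ker g).subtype) (ModuleCat.ofHom g)
      (by ext x; exact x.2)).ShortExact :=
  ModuleCat.shortExact_of_linearMap _ _ (Submodule.subtype_injective _)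
    (LinearMap.exact_subtype_ker_map g) hg

lemma ModuleCat.shortExact_coker {A B : Type u} [AddCommGroup A] [Module R A]
    [AddCommGroup B] [Module R B] (f : A →ₗ[R] B) (hf : Function.Injective f) :
    (ShortComplex.mk (ModuleCat.ofHom f) (ModuleCat.ofHom (LinearMap.range f).mkQ)
      (by ext x; simp)).ShortExact :=
  ModuleCat.shortExact_of_linearMap _ _ hf (LinearMap.exact_map_mkQ_range f)
    (Submodule.mkQ_surjective _)

lemma ModuleCat.projective_finsupp (X : Type u) : Projective (ModuleCat.of R (X →₀ R)) :=
  (IsProjective.iff_projective _).1 inferInstance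

end ModuleUtilities

/-! ### The flat dimension of powers of the character module -/

section FlatDimension

open scoped Matrix

variable {R : Type u} [CommRing R]

/-- `A.TorVanishes X i` says that `Tor_{i+1}(coker A, X) = 0`, read off from an arbitrary
resolution of `coker A` by finite free modules that starts with `A`: one passes `i` times to a
matrix of syzygies, and then asks for exactness after `- ⊗ X`. This is meant for coherent rings,
where matrices of syzygies always exist. -/
def Matrix.TorVanishes (X : Type*) [AddCommGroup X] [Module R X] :
    ℕ → ∀ {a b : ℕ}, Matrix (Fin a) (Fin b) R → Prop
  | 0, _, b, A => ∀ (c : ℕ) (B : Matrix (Fin b) (Fin c) R), A.IsSyzygy B →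
      ∀ x, A.smulVec X x = 0 → ∃ y, B.smulVec X y = x
  | i + 1, _, b, A => ∀ (c : ℕ) (B : Matrix (Fin b) (Fin c) R), A.IsSyzygy B →
      TorVanishes X i B

lemma Matrix.TorVanishes.pi {X : Type*} [AddCommGroup X] [Module R X] (κ : Type*) {i : ℕ} :
    ∀ {a b : ℕ} {A : Matrix (Fin a) (Fin b) R}, A.TorVanishes X i →
      A.TorVanishes (κ → X) i := by
  induction i with
  | zero =>
    intro a b A h c B hB x hx
    have hy : ∀ k, ∃ y : Fin c → X, B.smulVec X y = fun j => x j k := fun k => by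
      refine h c B hB _ ?_
      ext1 r
      simpa [Matrix.smulVec_apply] using congrFun (congrFun hx r) k
    choose y hy using hy
    refine ⟨fun q k => y k q, ?_⟩
    ext j k
    rw [← congrFun (hy k) j, Matrix.smulVec_apply, Finset.sum_apply]
    rfl
  | succ i ih => exact fun h c B hB => ih (h c B hB)

/-- The cokernel of a matrix of syzygies of `A` is the first syzygy of the cokernel of `A`. -/
lemma Matrix.IsSyzygy.shortExact {a b c : ℕ} {A : Matrix (Fin a) (Fin b) R}
    {B : Matrix (Fin b) (Fin c) R} (h : A.IsSyzygy B) :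
    ∃ w, (ShortComplex.mk
      (ModuleCat.ofHom ((LinearMap.range (B.smulVec R)).liftQ (A.smulVec R)
        (LinearMap.exact_iff.1 h).ge))
      (ModuleCat.ofHom (LinearMap.range (A.smulVec R)).mkQ) w).ShortExact := by
  refine ⟨_, ModuleCat.shortExact_of_linearMap _ _ ?_ ?_ (Submodule.mkQ_surjective _)⟩
  · exact LinearMap.ker_eq_bot.1 (Submodule.ker_liftQ_eq_bot _ _ _ (LinearMap.exact_iff.1 h).le)
  · rw [LinearMap.exact_iff, Submodule.ker_mkQ, Submodule.range_liftQ]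

/-- If `Ext¹(coker A, R) = 0`, then the sequence given by `A` and its syzygies stays exact
under `Hom(-, R)`. -/
lemma Matrix.IsSyzygy.transpose_of_subsingleton_ext {a b c : ℕ} {A : Matrix (Fin a) (Fin b) R}
    {B : Matrix (Fin b) (Fin c) R} (h : A.IsSyzygy B)
    (hA : Subsingleton (Abelian.Ext.{u}
      (ModuleCat.of R ((Fin a → R) ⧸ LinearMap.range (A.smulVec R))) (ModuleCat.of R R) 1)) :
    Bᵀ.IsSyzygy Aᵀ := by
  intro v
  constructor
  · intro hv
    let φ : (Fin b → R) →ₗ[R] R := Fintype.linearCombination R v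
    have hφ : LinearMap.range (B.smulVec R) ≤ LinearMap.ker φ := by
      rintro _ ⟨w, rfl⟩
      have : ∑ k, (Bᵀ.smulVec R v k) * w k = 0 := by rw [hv]; simp
      rw [LinearMap.mem_ker, ← this]
      simp only [φ, Fintype.linearCombination_apply, Matrix.smulVec_apply, smul_eq_mul,
        Finset.sum_mul, Matrix.transpose_apply]
      rw [Finset.sum_comm]
      exact Finset.sum_congr rfl fun _ _ => Finset.sum_congr rfl fun _ _ => by ring
    obtain ⟨w, hS⟩ := h.shortExact
    obtain ⟨g, hg⟩ := hS.exists_extension hA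
      (ModuleCat.ofHom ((LinearMap.range (B.smulVec R)).liftQ φ hφ))
    have hg' (x : Fin b → R) : g.hom (A.smulVec R x) = φ x := by
      have := congr($(hg).hom (Submodule.Quotient.mk x))
      simpa using this
    refine ⟨fun i => g.hom (Pi.single i 1), ?_⟩
    ext j
    have h1 := hg' (Pi.single j 1)
    have h2 : A.smulVec R (Pi.single j 1) = ∑ i, A i j • Pi.single i (1 : R) := by
      ext i
      simp [Matrix.smulVec_apply, Finset.sum_apply, Pi.single_apply]
    rw [h2, map_sum] at h1
    simp only [map_smul] at h1
    have h3 : φ (Pi.single j 1) = v j := by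
      simp [φ, Fintype.linearCombination_apply, Pi.single_apply]
    rw [← h3, ← h1]
    rfl
  · rintro ⟨w, rfl⟩
    rw [← Matrix.smulVec_mul, ← Matrix.transpose_mul, h.mul_eq_zero]
    ext; simp [Matrix.smulVec_apply]

/-- The consequence for vanishing of the duality `Tor_{d+1}(P, R⁺) ≅ Ext^{d+1}(P, R)⁺`, which holds
for finitely presented modules `P` over a coherent ring. -/
lemma Matrix.torVanishes_characterModule {d : ℕ} :
    ∀ {a b : ℕ} {A : Matrix (Fin a) (Fin b) R}, Subsingleton (Abelian.Ext.{u}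
      (ModuleCat.of R ((Fin a → R) ⧸ LinearMap.range (A.smulVec R))) (ModuleCat.of R R) (d + 1)) →
      A.TorVanishes (CharacterModule R) d := by
  induction d with
  | zero =>
    intro a b A h c B hB x hx
    exact Matrix.exists_of_characterModule (hB.transpose_of_subsingleton_ext h) x hx
  | succ d ih =>
    intro a b A h c B hB
    refine ih ?_
    obtain ⟨w, hS⟩ := hB.shortExact
    have : Projective (ModuleCat.of R (Fin a → R)) := (IsProjective.iff_projective _).1 inferInstance
    exact hS.subsingleton_ext_X₁ (Abelian.Ext.subsingleton_of_projective _ _ _) h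

/-- Dimension shifting along `0 → ker g → F → X → 0` with `F` free. -/
lemma IsCoherentRing.torVanishes_ker (hR : IsCoherentRing R) {X κ : Type*} [AddCommGroup X]
    [Module R X] (g : (κ →₀ R) →ₗ[R] X) (hg : Function.Surjective g) {i : ℕ} :
    ∀ {a b : ℕ} {A : Matrix (Fin a) (Fin b) R}, A.TorVanishes X (i + 1) →
      A.TorVanishes (LinearMap.ker g) i := by
  induction i with
  | zero =>
    intro a b A h c B hB x hx
    obtain ⟨d, C, hC⟩ := hR.exists_isSyzygy B
    obtain ⟨y, hy⟩ := hB.exists_of_finsupp (fun j => (x j : κ →₀ R)) (by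
      ext1 r; rw [← Matrix.coe_smulVec, hx]; rfl)
    obtain ⟨z, hz⟩ := h c B hB d C hC (fun j => g (y j)) (by
      rw [B.smulVec_map g y, hy]; ext j; exact (x j).2)
    choose z' hz' using fun j => hg (z j)
    -- `y` lifts `x` through `B`, and differs from a tuple in `ker g` by a relation from `C`
    have hmem (j) : (y - C.smulVec _ z') j ∈ LinearMap.ker g := by
      have h1 := C.smulVec_map g z'
      simp only [hz'] at h1
      rw [LinearMap.mem_ker, Pi.sub_apply, map_sub, sub_eq_zero]
      exact (congrFun hz j).symm.trans (congrFun h1 j)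
    refine ⟨fun j => ⟨_, hmem j⟩, ?_⟩
    ext1 j
    apply Subtype.ext
    have h2 : B.smulVec (κ →₀ R) (y - C.smulVec _ z') = fun j => (x j : κ →₀ R) := by
      rw [map_sub, hy, ← Matrix.smulVec_mul, hC.mul_eq_zero]
      ext; simp [Matrix.smulVec_apply]
    rw [Matrix.coe_smulVec]
    exact congrFun h2 j
  | succ i ih => exact fun h c B hB => ih (h c B hB)

/-- A module with vanishing `Tor₁` against all finitely presented modules is flat. -/
lemma IsCoherentRing.flat_of_torVanishes (hR : IsCoherentRing R) {X : Type*} [AddCommGroup X]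
    [Module R X] (h : ∀ {a b : ℕ} (A : Matrix (Fin a) (Fin b) R), A.TorVanishes X 0) :
    Module.Flat R X := by
  refine Module.Flat.of_forall_isTrivialRelation fun {l f x} hfx => ?_
  let A : Matrix (Fin 1) (Fin l) R := Matrix.of fun _ j => f j
  obtain ⟨c, B, hB⟩ := hR.exists_isSyzygy A
  obtain ⟨y, hy⟩ := h A c B hB x (by ext1 r; simpa [A, Matrix.smulVec_apply] using hfx)
  refine ⟨c, B, y, fun j => (congrFun hy j).symm, fun q => ?_⟩
  simpa [A, Matrix.mul_apply] using congrFun (congrFun hB.mul_eq_zero 0) q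

lemma IsCoherentRing.hasProjectiveDimensionLE_of_torVanishes (hR : IsCoherentRing R) {m : ℕ}
    (hm : IsNPerfect m R) {i : ℕ} : ∀ (X : Type u) [AddCommGroup X] [Module R X],
      (∀ {a b : ℕ} (A : Matrix (Fin a) (Fin b) R), A.TorVanishes X i) →
      HasProjectiveDimensionLE (ModuleCat.of R X) (m + i) := by
  induction i with
  | zero => exact fun X _ _ h => hm _ (hR.flat_of_torVanishes h)
  | succ i ih =>
    intro X _ _ h
    have h1 := ih (LinearMap.ker (Finsupp.linearCombination R (id : X → X)))
      fun A => hR.torVanishes_ker _ (Finsupp.linearCombination_id_surjective R X) (h A)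
    have := ModuleCat.projective_finsupp (R := R) X
    exact (ModuleCat.shortExact_ker _ (Finsupp.linearCombination_id_surjective R X)).hasProjectiveDimensionLT_X₃ (m + i + 1) h1
      (hasProjectiveDimensionLT_of_ge _ 1 _ (by omega))

lemma IsNFC.exists_subsingleton_ext {n : ℕ} (hn : IsNFC n R) :
    ∃ d : ℕ, ∀ P : ModuleCat.{u} R, Module.FinitePresentation R P →
      Subsingleton (Abelian.Ext.{u} P (ModuleCat.of R R) (d + 1)) := by
  by_contra! h
  have h1 := hn.2
  rw [fpInjectiveDimension, iInf_congr fun d => iInf_neg (by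
    obtain ⟨P, hP, hP'⟩ := h d
    exact fun h => not_subsingleton_iff_nontrivial.2 hP' (h P hP))] at h1
  simp at h1

/-- The powers of `R⁺`, into which every module embeds for a suitable exponent, have finite
projective dimension. -/
lemma IsNFC.hasProjectiveDimensionLE_pi_characterModule {n m : ℕ} (hn : IsNFC n R)
    (hm : IsNPerfect m R) (κ : Type u) :
    ∃ d, HasProjectiveDimensionLE (ModuleCat.of R (κ → CharacterModule R)) d := by
  obtain ⟨d, hd⟩ := hn.exists_subsingleton_ext
  refine ⟨m + d, hn.1.hasProjectiveDimensionLE_of_torVanishes hm _ fun {a b} A => ?_⟩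
  refine Matrix.TorVanishes.pi κ (Matrix.torVanishes_characterModule (hd _ ?_))
  exact Module.finitePresentation_of_surjective _ (Submodule.mkQ_surjective _) (by
    rw [Submodule.ker_mkQ, LinearMap.range_eq_map]; exact Module.Finite.fg_top.map _)

lemma exists_injective_pi_characterModule (K : Type u) [AddCommGroup K] [Module R K] :
    ∃ f : K →ₗ[R] (CharacterModule K → CharacterModule R), Function.Injective f := by
  refine ⟨LinearMap.pi fun c =>
    { toFun := fun k => CharacterModule.dual (LinearMap.toSpanSingleton R K k) c
      map_add' := fun x y => CharacterModule.ext R fun r => by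
        change c (r • (x + y)) = c (r • x) + c (r • y)
        rw [smul_add, map_add]
      map_smul' := fun s x => CharacterModule.ext R fun r => by
        change c (r • s • x) = c ((s • r) • x)
        rw [smul_smul, smul_eq_mul, mul_comm] }, ?_⟩
  refine (injective_iff_map_eq_zero _).2 fun k hk => CharacterModule.eq_zero_of_character_apply
    fun c => ?_
  have : c ((1 : R) • k) = 0 := congr($(congrFun hk c) 1)
  rwa [one_smul] at this

end FlatDimension

/-! ### Modules orthogonal to the modules of finite projective dimension -/

section Orthogonal

open Abelian

variable {R : Type u} [CommRing R]

/-- `M` is left `Ext`-orthogonal to the modules of finite projective dimension. -/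
def IsExtOrthogonal (M : ModuleCat.{u} R) : Prop :=
  ∀ j : ℕ, 1 ≤ j → ∀ P : ModuleCat.{u} R, (∃ d : ℕ, HasProjectiveDimensionLE P d) →
    Subsingleton (Ext.{u} M P j)

/-- Orthogonality may be tested against projective modules, by dimension shifting in the second
variable. -/
lemma isExtOrthogonal_of_projective_right {M : ModuleCat.{u} R}
    (h : ∀ j : ℕ, 1 ≤ j → ∀ Q : ModuleCat.{u} R, Projective Q → Subsingleton (Ext.{u} M Q j)) :
    IsExtOrthogonal M := by
  rintro j hj P ⟨d, hd⟩
  induction d generalizing j P with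
  | zero => exact h j hj P ((projective_iff_hasProjectiveDimensionLE_zero _).2 hd)
  | succ d ih =>
    have hS := ModuleCat.shortExact_ker _ (Finsupp.linearCombination_id_surjective R P)
    have hF := ModuleCat.projective_finsupp (R := R) P
    exact hS.subsingleton_ext_to_X₃ (h j hj _ hF)
      (ih (j + 1) (by omega) _ ((hS.hasProjectiveDimensionLT_X₃_iff d hF).1 hd))

lemma isExtOrthogonal_of_projective (M : ModuleCat.{u} R) [Projective M] : IsExtOrthogonal M := by
  rintro (_ | j) hj P -
  · omega
  · exact Ext.subsingleton_of_projective _ _ _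

/-- A map `f` from `K` to a free module of any rank factors through the free module on `K × ℕ`,
by maps that do not change its values, because the supports of the `f k` are finite. This bounds
the size of the free modules needed to test `K`. -/
lemma exists_factor_through_finsupp {K : Type u} [AddCommGroup K] [Module R K] {X : Type u}
    (f : K →ₗ[R] (X →₀ R)) : ∃ (a : (X →₀ R) →ₗ[R] (K × ℕ →₀ R))
      (b : (K × ℕ →₀ R) →ₗ[R] (X →₀ R)), ∀ k, b (a (f k)) = f k := by
  cases isEmpty_or_nonempty X with
  | inl _ => exact ⟨0, 0, fun k => Subsingleton.elim _ _⟩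
  | inr hX =>
    -- `r` enumerates the union of the supports, and `e` chooses preimages
    let r : K × ℕ → X := fun y => (f y.1).support.toList.getD y.2 (Classical.arbitrary X)
    let e : X → K × ℕ := Function.invFun r
    refine ⟨Finsupp.lmapDomain R R e, Finsupp.lmapDomain R R r, fun k => ?_⟩
    rw [Finsupp.lmapDomain_apply, Finsupp.lmapDomain_apply, ← Finsupp.mapDomain_comp]
    refine (Finsupp.mapDomain_congr fun x hx => ?_).trans Finsupp.mapDomain_id
    refine Function.invFun_eq (f := r) ?_
    obtain ⟨n, hn, hx⟩ := List.mem_iff_getElem.1 (Finset.mem_toList.2 hx)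
    exact ⟨(k, n), (List.getD_eq_getElem _ _ hn).trans hx⟩

/-- Over an `n`-FC and `m`-perfect ring, a module orthogonal to the modules of finite projective
dimension embeds into a free module, with cokernel again orthogonal. -/
lemma IsExtOrthogonal.exists_embedding {n m : ℕ} (hn : IsNFC n R) (hm : IsNPerfect m R)
    {K : ModuleCat.{u} R} (hK : IsExtOrthogonal K) :
    ∃ (F C : ModuleCat.{u} R) (i : K ⟶ F) (p : F ⟶ C) (w : i ≫ p = 0),
      (ShortComplex.mk i p w).ShortExact ∧ Projective F ∧ IsExtOrthogonal C := by
  -- a map from `K` to a module of finite projective dimension factors through a free cover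
  have lift (N : Type u) [AddCommGroup N] [Module R N]
      (hN : ∃ d, HasProjectiveDimensionLE (ModuleCat.of R N) d) (f : K →ₗ[R] N) :
      ∃ g : K →ₗ[R] (N →₀ R), Finsupp.linearCombination R id ∘ₗ g = f := by
    obtain ⟨d, hd⟩ := hN
    have hS := ModuleCat.shortExact_ker _ (Finsupp.linearCombination_id_surjective R N)
    have hF := ModuleCat.projective_finsupp (R := R) N
    have h1 := hS.hasProjectiveDimensionLT_X₁ (d + 1)
      (hasProjectiveDimensionLT_of_ge _ 1 _ (by omega))
      (hasProjectiveDimensionLT_of_ge _ (d + 1) _ (by omega))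
    obtain ⟨g, hg⟩ := hS.exists_lift (hK 1 le_rfl _ ⟨d, h1⟩) (ModuleCat.ofHom f)
    exact ⟨g.hom, congr($(hg).hom)⟩
  let N := (K →ₗ[R] (K × ℕ →₀ R)) → (K × ℕ →₀ R)
  have hN : Module.Flat R N := hn.1.flat_pi_finsupp _ _
  obtain ⟨g, hg⟩ := lift N ⟨m, hm _ hN⟩ (LinearMap.pi fun f => f)
  -- `g` is a projective preenvelope: `N` was chosen such that every map from `K` to a projective
  -- module factors through `K → N`, hence through `g`
  have factor (Q : ModuleCat.{u} R) (hQ : Projective Q) (f : K →ₗ[R] Q) :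
      ∃ h : (N →₀ R) →ₗ[R] Q, h ∘ₗ g = f := by
    have : Module.Projective R Q := (IsProjective.iff_projective _).2 hQ
    obtain ⟨s, hs⟩ := Module.projective_def'.1 this
    obtain ⟨a, b, hab⟩ := exists_factor_through_finsupp (s ∘ₗ f)
    refine ⟨Finsupp.linearCombination R id ∘ₗ b ∘ₗ LinearMap.proj (a ∘ₗ s ∘ₗ f) ∘ₗ
      Finsupp.linearCombination R id, ?_⟩
    ext k
    have h1 := congr($hg k (a ∘ₗ s ∘ₗ f))
    have h2 := hab k
    have h3 := congr($hs (f k))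
    simp only [LinearMap.comp_apply, LinearMap.pi_apply, LinearMap.id_apply] at h1 h2 h3
    change Finsupp.linearCombination R id
      (b (Finsupp.linearCombination R id (g k) (a ∘ₗ s ∘ₗ f))) = f k
    rw [h1, h2, h3]
  -- a cogenerator of finite projective dimension provides an embedding of `K` into a free module,
  -- and this embedding factors through `g`
  have hg_inj : Function.Injective g := by
    obtain ⟨i, hi⟩ := exists_injective_pi_characterModule (R := R) K
    obtain ⟨i', hi'⟩ := lift _ (hn.hasProjectiveDimensionLE_pi_characterModule hm _) i
    obtain ⟨h, hh⟩ := factor _ (ModuleCat.projective_finsupp _) i'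
    refine Function.Injective.of_comp (f := Finsupp.linearCombination R id ∘ₗ h) ?_
    rw [← LinearMap.coe_comp, LinearMap.comp_assoc, hh, hi']
    exact hi
  have hS := ModuleCat.shortExact_coker g hg_inj
  have hF := ModuleCat.projective_finsupp (R := R) N
  refine ⟨_, _, _, _, _, hS, hF, isExtOrthogonal_of_projective_right fun j hj Q hQ => ?_⟩
  have hQ' : ∃ d, HasProjectiveDimensionLE Q d :=
    ⟨0, (projective_iff_hasProjectiveDimensionLE_zero _).1 hQ⟩
  obtain _ | _ | j := j
  · omega
  · refine hS.subsingleton_ext_one_X₃ (fun f => ?_) (Ext.subsingleton_of_projective _ _ _)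
    obtain ⟨h, hh⟩ := factor Q hQ f.hom
    exact ⟨ModuleCat.ofHom h, ModuleCat.hom_ext hh⟩
  · exact hS.subsingleton_ext_X₃ (hK _ (by omega) Q hQ') (Ext.subsingleton_of_projective _ _ _)

end Orthogonal

/-! ### Complete resolutions -/

section GorensteinProjective

open Abelian

variable {R : Type u} [CommRing R]

lemma HomologicalComplex.Acyclic.function_exact {P : CochainComplex (ModuleCat.{u} R) ℤ}
    (hP : P.Acyclic) (j : ℤ) : Function.Exact (P.d j (j + 1)) (P.d (j + 1) (j + 1 + 1)) := by
  have := (P.exactAt_iff' j (j + 1) (j + 1 + 1) (by simp) (by simp)).1 (hP (j + 1))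
  exact (ShortComplex.ShortExact.moduleCat_exact_iff_function_exact _).1 this

/-- The images in a complete resolution all have vanishing `Ext` into projective modules:
`Ext¹` vanishes by the exactness under `Hom(-, Q)`, and the higher `Ext` by dimension shifting. -/
lemma IsGorensteinProjective.isExtOrthogonal {M : ModuleCat.{u} R}
    (hM : IsGorensteinProjective M) : IsExtOrthogonal M := by
  obtain ⟨P, hproj, hac, hhom, ⟨e⟩⟩ := hM
  let B (j : ℤ) : ModuleCat.{u} R := ModuleCat.of R (LinearMap.range (P.d j (j + 1)).hom)
  have hS (j : ℤ) := ModuleCat.shortExact_of_linearMap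
    (LinearMap.range (P.d j (j + 1)).hom).subtype (P.d (j + 1) (j + 1 + 1)).hom.rangeRestrict
    (Submodule.subtype_injective _) (by
      rw [LinearMap.exact_iff, LinearMap.ker_rangeRestrict, Submodule.range_subtype]
      exact LinearMap.exact_iff.1 (HomologicalComplex.Acyclic.function_exact hac j))
    (LinearMap.surjective_rangeRestrict _)
  have hB (t : ℕ) : ∀ j (Q : ModuleCat.{u} R), Projective Q →
      Subsingleton (Ext.{u} (B j) Q (t + 1)) := by
    induction t with
    | zero =>
      intro j Q hQ
      obtain ⟨j, rfl⟩ : ∃ i, j = i + 1 := ⟨j - 1, by ring⟩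
      have := hproj (j + 1)
      refine (hS j).subsingleton_ext_one_X₃ (fun f => ?_) (Ext.subsingleton_of_projective _ _ _)
      let q : P.X j ⟶ B j := ModuleCat.ofHom (P.d j (j + 1)).hom.rangeRestrict
      obtain ⟨g, hg⟩ := hhom Q hQ j (q ≫ f) (by
        have h0 : P.d (j - 1) j ≫ q = 0 := by
          ext x
          exact congr($(P.d_comp_d (j - 1) j (j + 1)).hom x)
        rw [← Category.assoc, h0, Limits.zero_comp])
      refine ⟨g, ?_⟩
      ext ⟨_, x, rfl⟩
      exact congr($(hg).hom x)
    | succ t ih =>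
      intro j Q hQ
      obtain ⟨j, rfl⟩ : ∃ i, j = i + 1 := ⟨j - 1, by ring⟩
      have := hproj (j + 1)
      exact (hS j).subsingleton_ext_X₃ (ih j Q hQ) (Ext.subsingleton_of_projective _ _ _)
  refine isExtOrthogonal_of_projective_right fun j hj Q hQ => ?_
  obtain ⟨t, rfl⟩ : ∃ t, j = t + 1 := ⟨j - 1, by omega⟩
  have hB' (i j) (hij : i + 1 = j) : Subsingleton
      (Ext.{u} (ModuleCat.of R (LinearMap.range (P.d i j).hom)) Q (t + 1)) := by
    subst hij
    exact hB t i Q hQ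
  exact e.symm.toModuleIso.subsingleton_ext (hB' _ _ rfl)

/-- Splicing short exact sequences `0 → Z n → F n → Z (n + 1) → 0` of orthogonal modules with
projective middle terms gives a complete resolution. -/
lemma isGorensteinProjective_of_shortExact (Z F : ℤ → ModuleCat.{u} R)
    (ι : ∀ n, Z n ⟶ F n) (p : ∀ n, F n ⟶ Z (n + 1)) (w : ∀ n, ι n ≫ p n = 0)
    (hS : ∀ n, (ShortComplex.mk (ι n) (p n) (w n)).ShortExact)
    (hF : ∀ n, Projective (F n)) (hZ : ∀ n, IsExtOrthogonal (Z n)) :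
    IsGorensteinProjective (Z 0) := by
  have hι (n) : Function.Injective (ι n) := (hS n).moduleCat_injective_f
  have hp (n) : Function.Surjective (p n) := (hS n).moduleCat_surjective_g
  have hex (n) : Function.Exact (ι n) (p n) :=
    (ShortComplex.ShortExact.moduleCat_exact_iff_function_exact _).1 (hS n).exact
  have sq (n) : (p n ≫ ι (n + 1)) ≫ (p (n + 1) ≫ ι (n + 1 + 1)) = 0 := by
    rw [Category.assoc, ← Category.assoc (ι (n + 1)), w, Limits.zero_comp, Limits.comp_zero]
  let P : CochainComplex (ModuleCat.{u} R) ℤ := CochainComplex.of F (fun n => p n ≫ ι (n + 1)) sq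
  have hd (n) : P.d n (n + 1) = p n ≫ ι (n + 1) := CochainComplex.of_d F (fun n => p n ≫ ι (n + 1)) n
  refine ⟨P, hF, fun j => ?_, fun Q hQ j f hf => ?_, ⟨?_⟩⟩
  · obtain ⟨j, rfl⟩ : ∃ i, j = i + 1 := ⟨j - 1, by ring⟩
    refine (P.exactAt_iff' j (j + 1) (j + 1 + 1) (by simp) (by simp)).2 ?_
    refine (ShortComplex.ShortExact.moduleCat_exact_iff_function_exact _).2 ?_
    change Function.Exact (P.d j (j + 1)) (P.d (j + 1) (j + 1 + 1))
    rw [hd, hd]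
    intro x
    constructor
    · intro hx
      have h1 : p (j + 1) x = 0 := hι _ (by rw [map_zero]; exact hx)
      obtain ⟨z, rfl⟩ := (hex (j + 1) x).1 h1
      obtain ⟨y, rfl⟩ := hp j z
      exact ⟨y, rfl⟩
    · rintro ⟨y, rfl⟩
      exact congr($(sq j).hom y)
  · obtain ⟨j, rfl⟩ : ∃ i, j = i + 1 := ⟨j - 1, by ring⟩
    rw [add_sub_cancel_right, hd, Category.assoc] at hf
    have := (hS j).epi_g
    have h1 : ι (j + 1) ≫ f = 0 := (cancel_epi (p j)).1 (hf.trans Limits.comp_zero.symm)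
    have := (hS (j + 1)).epi_g
    let f' : Z (j + 1 + 1) ⟶ Q := (hS (j + 1)).exact.desc f h1
    have hf' : p (j + 1) ≫ f' = f := (hS (j + 1)).exact.g_desc f h1
    obtain ⟨g, hg⟩ := (hS (j + 1 + 1)).exists_extension
      (hZ _ 1 le_rfl Q ⟨0, (projective_iff_hasProjectiveDimensionLE_zero _).1 hQ⟩) f'
    refine ⟨g, ?_⟩
    rw [hd, Category.assoc]
    exact (congrArg (p (j + 1) ≫ ·) hg).trans hf'
  · refine (LinearEquiv.ofInjective (ι 0).hom (hι 0)).trans (LinearEquiv.ofEq _ _ ?_)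
    have h1 : P.d (-1) 0 = p (-1) ≫ ι 0 := hd (-1)
    rw [h1, ModuleCat.hom_comp, LinearMap.range_comp_of_range_eq_top]
    exact LinearMap.range_eq_top.2 (hp (-1))

/-- A relation that can be continued in both directions has a bi-infinite chain through any
given element. -/
lemma exists_int_chain {α : Type*} {r : α → α → Prop} (hr : ∀ a, ∃ b, r a b)
    (hl : ∀ b, ∃ a, r a b) (x : α) : ∃ Z : ℤ → α, Z 0 = x ∧ ∀ n, r (Z n) (Z (n + 1)) := by
  choose f hf using hr
  choose g hg using hl
  refine ⟨fun n => n.casesOn (fun k => f^[k] x) (fun k => g^[k + 1] x), rfl, fun n => ?_⟩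
  rcases n with k | _ | k
  · have := hf (f^[k] x)
    rwa [← Function.iterate_succ_apply' f] at this
  · exact hg x
  · have := hg (g^[k + 1] x)
    rwa [← Function.iterate_succ_apply' g] at this

/-- The complete resolution is spliced from free covers on the left and from the embeddings into
free modules on the right. -/
lemma IsExtOrthogonal.isGorensteinProjective {n m : ℕ} (hn : IsNFC n R) (hm : IsNPerfect m R)
    {K : ModuleCat.{u} R} (hK : IsExtOrthogonal K) : IsGorensteinProjective K := by
  let r (A B : {A : ModuleCat.{u} R // IsExtOrthogonal A}) : Prop :=
    ∃ (F : ModuleCat.{u} R) (i : A.1 ⟶ F) (p : F ⟶ B.1) (w : i ≫ p = 0),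
      (ShortComplex.mk i p w).ShortExact ∧ Projective F
  obtain ⟨Z, hZ0, hZ⟩ := exists_int_chain (r := r) (fun A => by
      obtain ⟨F, C, i, p, w, hS, hF, hC⟩ := A.2.exists_embedding hn hm
      exact ⟨⟨C, hC⟩, F, i, p, w, hS, hF⟩) (fun B => by
      have hS := ModuleCat.shortExact_ker _ (Finsupp.linearCombination_id_surjective R B.1)
      have hF := ModuleCat.projective_finsupp (R := R) B.1
      exact ⟨⟨_, fun j hj P hP => hS.subsingleton_ext_X₁
        (isExtOrthogonal_of_projective _ j hj P hP) (B.2 (j + 1) (by omega) P hP)⟩,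
        _, _, _, _, hS, hF⟩) ⟨K, hK⟩
  choose F ι p w hS hF using hZ
  have := isGorensteinProjective_of_shortExact (fun n => (Z n).1) F ι p w hS hF fun n => (Z n).2
  rwa [hZ0] at this

end GorensteinProjective

/-! ### Gorenstein projective dimension -/

section GorensteinProjectiveDimension

open Abelian

variable {R : Type u} [CommRing R]

lemma subsingleton_ext_of_subsingleton {X : ModuleCat.{u} R} (hX : Subsingleton X)
    (Y : ModuleCat.{u} R) (j : ℕ) : Subsingleton (Ext.{u} X Y j) := by
  have := (ModuleCat.isZero_of_subsingleton X).hasProjectiveDimensionLT_zero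
  exact HasProjectiveDimensionLT.subsingleton X 0 j (Nat.zero_le _) Y

/-- Dimension shifting along a resolution of length `k`, from its left end. -/
lemma HasGorensteinProjectiveResolution.subsingleton_ext {M : ModuleCat.{u} R} {k : ℕ}
    (h : HasGorensteinProjectiveResolution M k) {j : ℕ} (hj : k + 1 ≤ j) {P : ModuleCat.{u} R}
    (hP : ∃ d : ℕ, HasProjectiveDimensionLE P d) : Subsingleton (Ext.{u} M P j) := by
  obtain ⟨G, ε, hG, hG0, hε, hexε, hex⟩ := h
  have hGext (i j) (hj : 1 ≤ j) : Subsingleton (Ext.{u} (G.X i) P j) := by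
    by_cases hi : i ≤ k
    · exact (hG i hi).isExtOrthogonal j hj P hP
    · exact subsingleton_ext_of_subsingleton (hG0 i (by omega)) _ _
  have hD (t : ℕ) : ∀ i, i + t = k → ∀ j, t ≤ j → Subsingleton
      (Ext.{u} (ModuleCat.of R (LinearMap.range (G.d (i + 1) i).hom)) P j) := by
    induction t with
    | zero =>
      intro i hi j _
      have := hG0 (i + 1) (by omega)
      exact subsingleton_ext_of_subsingleton
        (LinearMap.surjective_rangeRestrict (G.d (i + 1) i).hom).subsingleton _ _
    | succ t ih =>
      intro i hi j hj
      obtain ⟨j, rfl⟩ : ∃ j', j = j' + 1 := ⟨j - 1, by omega⟩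
      have hS := ModuleCat.shortExact_of_linearMap
        (LinearMap.range (G.d (i + 2) (i + 1)).hom).subtype (G.d (i + 1) i).hom.rangeRestrict
        (Submodule.subtype_injective _) (by
          rw [LinearMap.exact_iff, LinearMap.ker_rangeRestrict, Submodule.range_subtype]
          exact LinearMap.exact_iff.1 (hex i))
        (LinearMap.surjective_rangeRestrict _)
      exact hS.subsingleton_ext_X₃ (ih (i + 1) (by omega) j (by omega))
        (hGext (i + 1) (j + 1) (by omega))
  obtain ⟨j, rfl⟩ : ∃ j', j = j' + 1 := ⟨j - 1, by omega⟩
  have hS := ModuleCat.shortExact_of_linearMap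
    (LinearMap.range (G.d 1 0).hom).subtype ε.hom (Submodule.subtype_injective _) (by
      rw [LinearMap.exact_iff, Submodule.range_subtype]
      exact LinearMap.exact_iff.1 hexε) hε
  exact hS.subsingleton_ext_X₃ (hD k 0 (by omega) j (by omega)) (hGext 0 (j + 1) (by omega))

lemma IsGorensteinProjective.hasGorensteinProjectiveResolution {M : ModuleCat.{u} R}
    (hM : IsGorensteinProjective M) : HasGorensteinProjectiveResolution M 0 := by
  let G := (ChainComplex.single₀ (ModuleCat.{u} R)).obj M
  have h0 (i : ℕ) : Subsingleton (G.X (i + 1)) :=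
    ModuleCat.subsingleton_of_isZero (HomologicalComplex.isZero_single_obj_X _ _ _ _ (by simp))
  refine ⟨G, 𝟙 M, fun i hi => ?_, fun i hi => ?_, Function.surjective_id, ?_, fun i x => ?_⟩
  · obtain rfl : i = 0 := by omega
    exact hM
  · obtain ⟨i, rfl⟩ : ∃ t, i = t + 1 := ⟨i - 1, by omega⟩
    exact h0 i
  · intro x
    constructor
    · rintro rfl
      exact ⟨0, map_zero _⟩
    · rintro ⟨y, rfl⟩
      have := h0 0
      rw [Subsingleton.elim y 0, map_zero]
      rfl
  · have := h0 i
    have := h0 (i + 1)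
    constructor
    · intro
      exact ⟨0, Subsingleton.elim _ _⟩
    · intro
      rw [Subsingleton.elim x 0, map_zero]

lemma HasGorensteinProjectiveResolution.of_shortExact {K F M : ModuleCat.{u} R} {i : K ⟶ F}
    {p : F ⟶ M} {w : i ≫ p = 0} (hS : (ShortComplex.mk i p w).ShortExact)
    (hF : IsGorensteinProjective F) {k : ℕ} (h : HasGorensteinProjectiveResolution K k) :
    HasGorensteinProjectiveResolution M (k + 1) := by
  obtain ⟨G, ε, hG, hG0, hε, hexε, hex⟩ := h
  have hi : Function.Injective i := hS.moduleCat_injective_f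
  have hip : Function.Exact i p :=
    (ShortComplex.ShortExact.moduleCat_exact_iff_function_exact _).1 hS.exact
  have h0 : G.d 1 0 ≫ ε = 0 := by ext x; exact hexε.apply_apply_eq_zero x
  refine ⟨G.augment (ε ≫ i) (by rw [← Category.assoc, h0, Limits.zero_comp]), p, ?_, ?_,
    hS.moduleCat_surjective_g, ?_, ?_⟩
  · rintro (_ | t) ht
    · exact hF
    · exact hG t (by omega)
  · rintro (_ | t) ht
    · omega
    · exact hG0 t (by omega)
  · intro x
    refine (hip x).trans ⟨?_, ?_⟩
    · rintro ⟨y, rfl⟩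
      obtain ⟨z, rfl⟩ := hε y
      exact ⟨z, rfl⟩
    · rintro ⟨z, rfl⟩
      exact ⟨ε z, rfl⟩
  · rintro (_ | t)
    · intro x
      refine Iff.trans ⟨fun hx => hi ?_, fun hx => ?_⟩ (hexε x)
      · rw [map_zero]; exact hx
      · exact (congrArg i hx).trans (map_zero _)
    · exact hex t

lemma gorensteinProjectiveDimension_le_iff (M : ModuleCat.{u} R) (k : ℕ) :
    gorensteinProjectiveDimension M ≤ k ↔
      ∃ k' ≤ k, HasGorensteinProjectiveResolution M k' := by
  constructor
  · intro h
    by_contra! h'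
    have h1 : ((k + 1 : ℕ) : ℕ∞) ≤ gorensteinProjectiveDimension M :=
      le_iInf₂ fun k' hk' => by
        by_contra h2
        exact h' k' (by rw [not_le, Nat.cast_lt] at h2; omega) hk'
    have := Nat.cast_le.1 (h1.trans h)
    omega
  · rintro ⟨k', hk', h⟩
    exact (iInf₂_le k' h).trans (Nat.cast_le.2 hk')

/-- The `k`-th syzygy in a free resolution is orthogonal, hence Gorenstein projective. -/
lemma hasGorensteinProjectiveResolution_of_subsingleton_ext {n m : ℕ} (hn : IsNFC n R)
    (hm : IsNPerfect m R) {k : ℕ} {M : ModuleCat.{u} R}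
    (h : ∀ j : ℕ, k + 1 ≤ j → ∀ P : ModuleCat.{u} R, (∃ d : ℕ, HasProjectiveDimensionLE P d) →
      Subsingleton (Ext.{u} M P j)) : HasGorensteinProjectiveResolution M k := by
  induction k generalizing M with
  | zero =>
    exact (IsExtOrthogonal.isGorensteinProjective hn hm
      (by simpa [IsExtOrthogonal] using h)).hasGorensteinProjectiveResolution
  | succ k ih =>
    have hS := ModuleCat.shortExact_ker _ (Finsupp.linearCombination_id_surjective R M)
    have hF := ModuleCat.projective_finsupp (R := R) M
    refine .of_shortExact hS ((isExtOrthogonal_of_projective _).isGorensteinProjective hn hm)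
      (ih fun j hj P hP => ?_)
    exact hS.subsingleton_ext_X₁ (isExtOrthogonal_of_projective _ j (by omega) P hP)
      (h (j + 1) (by omega) P hP)

end GorensteinProjectiveDimension

theorem lemma2p2 {R : Type u} [CommRing R] (n m : ℕ) (hn : IsNFC n R) (hm : IsNPerfect m R)
    (M : ModuleCat.{u} R) (k : ℕ) :
    gorensteinProjectiveDimension M ≤ k ↔
      ∀ j : ℕ, k + 1 ≤ j → ∀ P : ModuleCat.{u} R, (∃ d : ℕ, HasProjectiveDimensionLE P d) →
        Subsingleton (Abelian.Ext.{u} M P j) := by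
  rw [gorensteinProjectiveDimension_le_iff]
  constructor
  · rintro ⟨k', hk', h⟩ j hj P hP
    exact h.subsingleton_ext (by omega) hP
  · exact fun h => ⟨k, le_rfl, hasGorensteinProjectiveResolution_of_subsingleton_ext hn hm h⟩
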